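/- Let $(M,g)$ be a smooth Riemannian manifold with Levi-Civita connection $\nabla^g$, and let $\nabla$ be a smooth flat metric connection on $TM$ whose torsion $T(X,Y,Z)=g(\nabla_XY-\nabla_YX-[X,Y],Z)$ is totally antisymmetric (a $3$-form). Let $U\subseteq M$ be open (for instance $U=M$) and let $e_1,\dots,e_n$ be a smooth $g$-orthonormal frame of $TM$ over $U$ that is $\nabla$-parallel, $\nabla e_i=0$. Denote by $$\mathcal R^g(X,Y)Z=\nabla^g_X\nabla^g_YZ-\nabla^g_Y\nabla^g_XZ-\nabla^g_{[X,Y]}Z$$ the Riemannian curvature tensor. Then the vector fields $e_1,\dots,e_n$ are Killing fields on $U$, and for all $i,j,k$ $$\mathcal R^g(e_i,e_j)e_k=-\tfrac14\,\big[[e_i,e_j],e_k\big]\quad\text{on } U.$$ In particular, each $\mathcal R^g(e_i,e_j)e_k$ is a Killing vector field on $U$. -/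

import Mathlib

open Bundle VectorField
open scoped Manifold ContDiff

noncomputable section

namespace SkewTorsion

section Connection

variable {E : Type*} [NormedAddCommGroup E] [NormedSpace ℝ E] [FiniteDimensional ℝ E]
  {M : Type*} [TopologicalSpace M] [ChartedSpace E M] [IsManifold 𝓘(ℝ, E) ∞ M]

/-- The curvature `R(X, Y) Z = ∇_X ∇_Y Z - ∇_Y ∇_X Z - ∇_{[X, Y]} Z` of a connection on the
tangent bundle. In Mathlib, `cov Z x (X x)` is the value of `∇_X Z` at `x`. -/
def curvature (cov : CovariantDerivative 𝓘(ℝ, E) E (fun x : M ↦ TangentSpace 𝓘(ℝ, E) x))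
    (X Y Z : Π x : M, TangentSpace 𝓘(ℝ, E) x) (x : M) : TangentSpace 𝓘(ℝ, E) x :=
  cov (fun y ↦ cov Z y (Y y)) x (X x) - cov (fun y ↦ cov Z y (X y)) x (Y x)
    - cov Z x (mlieBracket 𝓘(ℝ, E) X Y x)

/-- A connection is flat if its curvature vanishes on all smooth vector fields. -/
def IsFlat (cov : CovariantDerivative 𝓘(ℝ, E) E (fun x : M ↦ TangentSpace 𝓘(ℝ, E) x)) : Prop :=
  ∀ X Y Z : Π x : M, TangentSpace 𝓘(ℝ, E) x,
    CMDiff ∞ (T% X) → CMDiff ∞ (T% Y) → CMDiff ∞ (T% Z) → curvature cov X Y Z = 0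

end Connection

section Riemannian

variable {E : Type*} [NormedAddCommGroup E] [NormedSpace ℝ E] [FiniteDimensional ℝ E]
  {M : Type*} [TopologicalSpace M] [ChartedSpace E M] [IsManifold 𝓘(ℝ, E) ∞ M]
  [RiemannianBundle (fun x : M ↦ TangentSpace 𝓘(ℝ, E) x)]

/-- A connection is metric if `X g(Y, Z) = g(∇_X Y, Z) + g(Y, ∇_X Z)`. -/
def IsMetric
    (cov : CovariantDerivative 𝓘(ℝ, E) E (fun x : M ↦ TangentSpace 𝓘(ℝ, E) x)) : Prop :=
  ∀ (x : M) (v : TangentSpace 𝓘(ℝ, E) x) (Y Z : Π x : M, TangentSpace 𝓘(ℝ, E) x),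
    MDiffAt (T% Y) x → MDiffAt (T% Z) x →
      d% (fun y ↦ (inner ℝ (Y y) (Z y) : ℝ)) x v =
        inner ℝ (cov Y x v) (Z x) + inner ℝ (Y x) (cov Z x v)

/-- The torsion `T(u, v, w) = g(T(u, v), w)` is a 3-form: it is antisymmetric in all arguments. -/
def HasSkewTorsion
    (cov : CovariantDerivative 𝓘(ℝ, E) E (fun x : M ↦ TangentSpace 𝓘(ℝ, E) x)) : Prop :=
  ∀ (x : M) (u v w : TangentSpace 𝓘(ℝ, E) x),
    inner ℝ (cov.torsion x u v) w = - inner ℝ (cov.torsion x v u) w ∧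
    inner ℝ (cov.torsion x u v) w = - inner ℝ (cov.torsion x u w) v

/-- The Levi-Civita connection: the metric connection without torsion. -/
structure IsLeviCivita
    (cov : CovariantDerivative 𝓘(ℝ, E) E (fun x : M ↦ TangentSpace 𝓘(ℝ, E) x)) : Prop where
  metric : IsMetric cov
  torsion_eq_zero : cov.torsion = 0

/-- `e` is a smooth orthonormal frame of the tangent bundle over `U`, parallel for `cov`
on `U`. (The values of `e i` outside `U` play no role.) -/
structure IsParallelOrthonormalFrameOn
    (cov : CovariantDerivative 𝓘(ℝ, E) E (fun x : M ↦ TangentSpace 𝓘(ℝ, E) x))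
    {n : ℕ} (e : Fin n → Π x : M, TangentSpace 𝓘(ℝ, E) x) (U : Set M) : Prop where
  frame : IsLocalFrameOn 𝓘(ℝ, E) E ∞ e U
  orthonormal : ∀ x ∈ U, Orthonormal ℝ (fun i ↦ e i x)
  parallel : ∀ x ∈ U, ∀ i, cov (e i) x = 0

/-- `X` is a Killing vector field on the open set `U`: it is smooth on `U` and the Lie derivative
of the metric along `X` vanishes there, i.e. `X g(Y, Z) = g([X, Y], Z) + g(Y, [X, Z])`. -/
def IsKillingOn (X : Π x : M, TangentSpace 𝓘(ℝ, E) x) (U : Set M) : Prop :=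
  CMDiff[U] ∞ (T% X) ∧
  ∀ x ∈ U, ∀ Y Z : Π x : M, TangentSpace 𝓘(ℝ, E) x, MDiffAt (T% Y) x → MDiffAt (T% Z) x →
    d% (fun y ↦ (inner ℝ (Y y) (Z y) : ℝ)) x (X x) =
      inner ℝ (mlieBracket 𝓘(ℝ, E) X Y x) (Z x) + inner ℝ (Y x) (mlieBracket 𝓘(ℝ, E) X Z x)

end Riemannian

end SkewTorsion

end

/-!
In a `∇`-parallel orthonormal frame `e` the Lie brackets are given by the torsion,
`[e i, e j] = -T(e i, e j)`, so skew torsion says that the structure functions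
`c i j k = g([e i, e j], e k)` are totally antisymmetric. Since the inner products of the frame are
constant, this is the Killing equation for each `e i`. Koszul's argument then yields the
Levi-Civita connection in the frame, `∇^g_v (e i) = -1/2 T(v, e i)` (`leviCivita_frame`). It follows
that `R^g(e i, e j) e k` is a linear combination of iterated brackets and of the three vectors
`T([e i, e j], e k)`, `T([e j, e k], e i)` and `T([e i, e k], e j)`.

The structure functions need not be constant, so an iterated bracket such as `[[e i, e j], e k]`
contains their derivatives. These are controlled as follows. As `[e i, e j]` is a bracket of
Killing fields it is Killing, which makes the derivative of `c i j l` along `e k` antisymmetric in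
`k` and `l`; being already antisymmetric in `i`, `j`, `l`, it is antisymmetric in all four
indices. The Jacobi identity determines the cyclic sum of these derivatives over `i`, `j`, `k`,
whose three terms are now equal, and so determines each of them. This expresses `3 [[e i, e j], e k]`
through the three torsion terms (`three_smul_mlieBracket_mlieBracket`), and substitution gives
`R^g(e i, e j) e k = -1/4 [[e i, e j], e k]`. The right-hand side is an iterated bracket of Killing
fields, hence Killing.
-/

namespace SkewTorsion

open Filter
open scoped Topology

/-! ### Local behaviour of vector fields -/

section Germs

variable {E : Type*} [NormedAddCommGroup E] [NormedSpace ℝ E]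
  {M : Type*} [TopologicalSpace M] [ChartedSpace E M]
  {X Y Z : Π x : M, TangentSpace 𝓘(ℝ, E) x} {x : M} {U : Set M}

lemma mvfderiv_congr {f g : M → ℝ} (h : f =ᶠ[𝓝 x] g) : d% f x = d% g x := by
  have h' := h.eq_of_nhds
  ext v
  simp only [mvfderiv, h.mfderiv_eq]
  rfl

variable [IsManifold 𝓘(ℝ, E) ∞ M]

lemma mdifferentiableAt_section_congr (h : X =ᶠ[𝓝 x] Y) (hY : MDiffAt (T% Y) x) :
    MDiffAt (T% X) x := by
  refine hY.congr_of_eventuallyEq ?_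
  filter_upwards [h] with y hy
  simp [hy]

lemma mdifferentiableAt_of_contMDiffOn (hU : IsOpen U) (hX : CMDiff[U] ∞ (T% X)) (hx : x ∈ U) :
    MDiffAt (T% X) x :=
  (hX.contMDiffAt (hU.mem_nhds hx)).mdifferentiableAt (by simp)

lemma cov_congr (cov : CovariantDerivative 𝓘(ℝ, E) E (fun x : M ↦ TangentSpace 𝓘(ℝ, E) x))
    (h : X =ᶠ[𝓝 x] Y) (hY : MDiffAt (T% Y) x) : cov X x = cov Y x :=
  cov.isCovariantDerivativeOnUniv.congr_of_eventuallyEq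
    (mdifferentiableAt_section_congr h hY) hY univ_mem h

variable [FiniteDimensional ℝ E]

lemma contMDiffOn_mlieBracket (hU : IsOpen U) (hX : CMDiff[U] ∞ (T% X))
    (hY : CMDiff[U] ∞ (T% Y)) : CMDiff[U] ∞ (T% (mlieBracket 𝓘(ℝ, E) X Y)) := by
  intro y hy
  have h : IsManifold 𝓘(ℝ, E) (((⊤ : ℕ∞) : ℕ∞ω) + 1) M := by
    simpa using! (inferInstance : IsManifold 𝓘(ℝ, E) ∞ M)
  have h' : IsManifold 𝓘(ℝ, E) (minSmoothness ℝ 2) M := by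
    rw [minSmoothness_of_isRCLikeNormedField]; infer_instance
  exact (ContMDiffAt.mlieBracket_vectorField (m := ⊤) (n := ⊤) (hX.contMDiffAt (hU.mem_nhds hy))
    (hY.contMDiffAt (hU.mem_nhds hy)) (by simp)).contMDiffWithinAt

lemma jacobi_mlieBracket (hU : IsOpen U) (hX : CMDiff[U] ∞ (T% X)) (hY : CMDiff[U] ∞ (T% Y))
    (hZ : CMDiff[U] ∞ (T% Z)) (hx : x ∈ U) :
    mlieBracket 𝓘(ℝ, E) (mlieBracket 𝓘(ℝ, E) X Y) Z x =
      mlieBracket 𝓘(ℝ, E) X (mlieBracket 𝓘(ℝ, E) Y Z) x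
        - mlieBracket 𝓘(ℝ, E) Y (mlieBracket 𝓘(ℝ, E) X Z) x := by
  have h : IsManifold 𝓘(ℝ, E) (minSmoothness ℝ 3) M := by
    rw [minSmoothness_of_isRCLikeNormedField]; infer_instance
  have hle : minSmoothness ℝ 2 ≤ (∞ : ℕ∞ω) := by
    rw [minSmoothness_of_isRCLikeNormedField]; exact ENat.LEInfty.out
  have hmem := hU.mem_nhds hx
  rw [leibniz_identity_mlieBracket_apply ((hX.contMDiffAt hmem).of_le hle)
    ((hY.contMDiffAt hmem).of_le hle) ((hZ.contMDiffAt hmem).of_le hle)]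
  abel

end Germs

/-! ### Killing fields and orthonormal frames -/

section Riemannian

variable {E : Type*} [NormedAddCommGroup E] [NormedSpace ℝ E]
  {M : Type*} [TopologicalSpace M] [ChartedSpace E M] [IsManifold 𝓘(ℝ, E) ∞ M]
  [RiemannianBundle (fun x : M ↦ TangentSpace 𝓘(ℝ, E) x)]
  {nabla nablaG : CovariantDerivative 𝓘(ℝ, E) E (fun x : M ↦ TangentSpace 𝓘(ℝ, E) x)}
  {U : Set M} {X Y Z : Π x : M, TangentSpace 𝓘(ℝ, E) x} {x : M}

lemma mdifferentiableAt_inner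
    [IsContMDiffRiemannianBundle 𝓘(ℝ, E) ∞ E (fun x : M ↦ TangentSpace 𝓘(ℝ, E) x)]
    (hX : MDiffAt (T% X) x) (hY : MDiffAt (T% Y) x) :
    MDiffAt (fun y ↦ (inner ℝ (X y) (Y y) : ℝ)) x :=
  MDifferentiableAt.inner_bundle hX hY

lemma IsKillingOn.congr (hX : IsKillingOn X U) (hU : IsOpen U) (h : ∀ y ∈ U, Y y = X y) :
    IsKillingOn Y U := by
  refine ⟨hX.1.congr fun y hy ↦ by simp [h y hy], fun x hx V W hV hW ↦ ?_⟩
  have hYX : Y =ᶠ[𝓝 x] X := eventually_of_mem (hU.mem_nhds hx) h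
  rw [hYX.mlieBracket_vectorField_eq (EventuallyEq.refl _ V),
    hYX.mlieBracket_vectorField_eq (EventuallyEq.refl _ W), h x hx]
  exact hX.2 x hx V W hV hW

namespace IsParallelOrthonormalFrameOn

variable {n : ℕ} {e : Fin n → Π x : M, TangentSpace 𝓘(ℝ, E) x}

lemma contMDiffOn (he : IsParallelOrthonormalFrameOn nabla e U) (i : Fin n) :
    CMDiff[U] ∞ (T% (e i)) :=
  he.frame.contMDiffOn i

lemma mdifferentiableAt (he : IsParallelOrthonormalFrameOn nabla e U) (hU : IsOpen U)
    (hx : x ∈ U) (i : Fin n) : MDiffAt (T% (e i)) x :=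
  mdifferentiableAt_of_contMDiffOn hU (he.contMDiffOn i) hx

/-- The inner products of the frame are constant. -/
lemma mvfderiv_inner (he : IsParallelOrthonormalFrameOn nabla e U) (hU : IsOpen U)
    (hx : x ∈ U) (i j : Fin n) :
    d% (fun y ↦ (inner ℝ (e i y) (e j y) : ℝ)) x = 0 := by
  rw [mvfderiv_congr (g := fun _ ↦ if i = j then 1 else 0), mvfderiv_const]
  filter_upwards [hU.mem_nhds hx] with y hy
  exact orthonormal_iff_ite.1 (he.orthonormal y hy) i j

lemma ext_inner (he : IsParallelOrthonormalFrameOn nabla e U) (hx : x ∈ U)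
    {u v : TangentSpace 𝓘(ℝ, E) x} (h : ∀ i, (inner ℝ u (e i x) : ℝ) = inner ℝ v (e i x)) :
    u = v := by
  refine InnerProductSpace.ext_inner_right_basis (𝕜 := ℝ) (he.frame.toBasisAt hx) fun i ↦ ?_
  simpa using h i

end IsParallelOrthonormalFrameOn

variable [FiniteDimensional ℝ E]

lemma IsKillingOn.const_smul (hX : IsKillingOn X U) (hU : IsOpen U) (a : ℝ) :
    IsKillingOn (a • X) U := by
  refine ⟨hX.1.const_smul_section, fun x hx Y Z hY hZ ↦ ?_⟩
  have hXd := mdifferentiableAt_of_contMDiffOn hU hX.1 hx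
  rw [mlieBracket_const_smul_left hXd, mlieBracket_const_smul_left hXd, Pi.smul_apply, map_smul,
    hX.2 x hx Y Z hY hZ, inner_smul_left, inner_smul_right, smul_eq_mul, mul_add]
  simp

lemma IsLeviCivita.mlieBracket_eq (hLC : IsLeviCivita nablaG) (hX : MDiffAt (T% X) x)
    (hY : MDiffAt (T% Y) x) :
    mlieBracket 𝓘(ℝ, E) X Y x = nablaG Y x (X x) - nablaG X x (Y x) :=
  (nablaG.torsion_eq_zero_iff.1 hLC.torsion_eq_zero hX hY).symm

/-- The Lie derivative of the metric is the symmetric part of `∇^g X`; in particular it depends on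
`Y` and `Z` only through their values at the point. -/
lemma IsLeviCivita.lieDerivative_metric (hLC : IsLeviCivita nablaG) (hX : MDiffAt (T% X) x)
    (hY : MDiffAt (T% Y) x) (hZ : MDiffAt (T% Z) x) :
    d% (fun y ↦ (inner ℝ (Y y) (Z y) : ℝ)) x (X x) -
      (inner ℝ (mlieBracket 𝓘(ℝ, E) X Y x) (Z x) + inner ℝ (Y x) (mlieBracket 𝓘(ℝ, E) X Z x)) =
    inner ℝ (nablaG X x (Y x)) (Z x) + inner ℝ (Y x) (nablaG X x (Z x)) := by
  rw [hLC.metric x (X x) Y Z hY hZ, hLC.mlieBracket_eq hX hY, hLC.mlieBracket_eq hX hZ,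
    inner_sub_left, inner_sub_right]
  ring

/-- `X` is Killing iff the endomorphism `∇^g X` is skew-symmetric. -/
lemma IsLeviCivita.isKillingOn_iff (hLC : IsLeviCivita nablaG) (hU : IsOpen U)
    (hX : CMDiff[U] ∞ (T% X)) :
    IsKillingOn X U ↔ ∀ x ∈ U, ∀ u v : TangentSpace 𝓘(ℝ, E) x,
      (inner ℝ (nablaG X x u) v : ℝ) + inner ℝ u (nablaG X x v) = 0 := by
  constructor
  · intro h x hx u v
    have hX' := mdifferentiableAt_of_contMDiffOn hU hX hx
    have hu := FiberBundle.mdifferentiableAt_extend 𝓘(ℝ, E) E u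
    have hv := FiberBundle.mdifferentiableAt_extend 𝓘(ℝ, E) E v
    have := hLC.lieDerivative_metric hX' hu hv
    rw [h.2 x hx _ _ hu hv, sub_self] at this
    simpa using this.symm
  · intro h
    refine ⟨hX, fun x hx Y Z hY hZ ↦ ?_⟩
    have := hLC.lieDerivative_metric (mdifferentiableAt_of_contMDiffOn hU hX hx) hY hZ
    rw [h x hx] at this
    linarith

namespace IsParallelOrthonormalFrameOn

variable {n : ℕ} {e : Fin n → Π x : M, TangentSpace 𝓘(ℝ, E) x}

/-- The Killing equation may be tested on an orthonormal frame, where the derivative of the inner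
products vanishes. -/
lemma isKillingOn_iff (he : IsParallelOrthonormalFrameOn nabla e U) (hLC : IsLeviCivita nablaG)
    (hU : IsOpen U) (hX : CMDiff[U] ∞ (T% X)) :
    IsKillingOn X U ↔ ∀ x ∈ U, ∀ k l,
      (inner ℝ (mlieBracket 𝓘(ℝ, E) X (e k) x) (e l x) : ℝ)
        + inner ℝ (mlieBracket 𝓘(ℝ, E) X (e l) x) (e k x) = 0 := by
  constructor
  · intro h x hx k l
    have := h.2 x hx _ _ (he.mdifferentiableAt hU hx k) (he.mdifferentiableAt hU hx l)
    rw [he.mvfderiv_inner hU hx] at this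
    rw [real_inner_comm (e k x)]
    exact this.symm
  · -- In terms of `∇^g X` the equation is bilinear in two tangent vectors, so a basis suffices.
    rw [hLC.isKillingOn_iff hU hX]
    intro h x hx u v
    let A : TangentSpace 𝓘(ℝ, E) x →ₗ[ℝ] TangentSpace 𝓘(ℝ, E) x →ₗ[ℝ] ℝ :=
      (innerₗ _).comp (nablaG X x).toLinearMap + ((innerₗ _).comp (nablaG X x).toLinearMap).flip
    suffices A = 0 by
      have := congr($this u v)
      simpa [A, real_inner_comm] using this
    refine (he.frame.toBasisAt hx).ext fun k ↦ (he.frame.toBasisAt hx).ext fun l ↦ ?_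
    have h1 := hLC.lieDerivative_metric (mdifferentiableAt_of_contMDiffOn hU hX hx)
      (he.mdifferentiableAt hU hx k) (he.mdifferentiableAt hU hx l)
    have h2 := h x hx k l
    rw [real_inner_comm (e k x)] at h2
    rw [he.mvfderiv_inner hU hx, h2, zero_apply, sub_zero] at h1
    simpa [A, real_inner_comm] using h1.symm

/-! ### Brackets and the Levi-Civita connection in a parallel frame -/

lemma mlieBracket_eq_neg_torsion (he : IsParallelOrthonormalFrameOn nabla e U) (hU : IsOpen U)
    (hx : x ∈ U) (i j : Fin n) :
    mlieBracket 𝓘(ℝ, E) (e i) (e j) x = -nabla.torsion x (e i x) (e j x) := by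
  rw [nabla.torsion_apply (he.mdifferentiableAt hU hx i) (he.mdifferentiableAt hU hx j),
    he.parallel x hx, he.parallel x hx]
  simp

lemma isKillingOn_frame (he : IsParallelOrthonormalFrameOn nabla e U) (hLC : IsLeviCivita nablaG)
    (hskew : HasSkewTorsion nabla) (hU : IsOpen U) (i : Fin n) : IsKillingOn (e i) U := by
  refine (he.isKillingOn_iff hLC hU (he.contMDiffOn i)).2 fun x hx k l ↦ ?_
  rw [he.mlieBracket_eq_neg_torsion hU hx, he.mlieBracket_eq_neg_torsion hU hx, inner_neg_left,
    inner_neg_left, (hskew x (e i x) (e k x) (e l x)).2]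
  ring

/-- In the frame, the Levi-Civita connection is half of minus the torsion, by Koszul's argument:
the Christoffel symbols are totally antisymmetric. -/
lemma leviCivita_frame (he : IsParallelOrthonormalFrameOn nabla e U) (hLC : IsLeviCivita nablaG)
    (hskew : HasSkewTorsion nabla) (hU : IsOpen U) (hx : x ∈ U) (i : Fin n)
    (v : TangentSpace 𝓘(ℝ, E) x) :
    nablaG (e i) x v = -(1 / 2 : ℝ) • nabla.torsion x v (e i x) := by
  have he' := he.mdifferentiableAt hU hx
  have metric (a b c) : (inner ℝ (nablaG (e b) x (e a x)) (e c x) : ℝ)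
      + inner ℝ (nablaG (e c) x (e a x)) (e b x) = 0 := by
    have := hLC.metric x (e a x) _ _ (he' b) (he' c)
    rw [he.mvfderiv_inner hU hx, zero_apply] at this
    rw [real_inner_comm (e b x)]
    exact this.symm
  have killing (a b c) : (inner ℝ (nablaG (e b) x (e a x)) (e c x) : ℝ)
      + inner ℝ (nablaG (e b) x (e c x)) (e a x) = 0 := by
    have := (hLC.isKillingOn_iff hU (he.contMDiffOn b)).1 (he.isKillingOn_frame hLC hskew hU b)
      x hx (e a x) (e c x)
    rwa [real_inner_comm (e a x)]
  have key (j) : nablaG (e i) x (e j x) = -(1 / 2 : ℝ) • nabla.torsion x (e j x) (e i x) := by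
    refine he.ext_inner hx fun k ↦ ?_
    have h := congr((inner ℝ $(hLC.mlieBracket_eq (he' j) (he' i)) (e k x) : ℝ))
    rw [he.mlieBracket_eq_neg_torsion hU hx, inner_sub_left, inner_neg_left] at h
    rw [inner_smul_left]
    simp only [conj_trivial]
    linarith [killing i j k, metric k j i, killing j i k]
  suffices (nablaG (e i) x).toLinearMap
      = (-(1 / 2 : ℝ) • (nabla.torsion x).flip (e i x)).toLinearMap from congr($this v)
  refine (he.frame.toBasisAt hx).ext fun j ↦ ?_
  simpa using key j

/-- The derivative along `e k` of the structure function `g([e i, e j], e l)` is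
`g(∇_{e k} [e i, e j], e l)`, rewritten through the torsion. -/
lemma mvfderiv_structureFunction (he : IsParallelOrthonormalFrameOn nabla e U)
    (hmetric : IsMetric nabla) (hU : IsOpen U) (hx : x ∈ U) (i j k l : Fin n) :
    d% (fun y ↦ (inner ℝ (mlieBracket 𝓘(ℝ, E) (e i) (e j) y) (e l y) : ℝ)) x (e k x) =
      -inner ℝ (nabla.torsion x (mlieBracket 𝓘(ℝ, E) (e i) (e j) x) (e k x)) (e l x)
        - inner ℝ (mlieBracket 𝓘(ℝ, E) (mlieBracket 𝓘(ℝ, E) (e i) (e j)) (e k) x) (e l x) := by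
  have hb := mdifferentiableAt_of_contMDiffOn hU
    (contMDiffOn_mlieBracket hU (he.contMDiffOn i) (he.contMDiffOn j)) hx
  rw [hmetric x (e k x) _ _ hb (he.mdifferentiableAt hU hx l),
    nabla.torsion_apply hb (he.mdifferentiableAt hU hx k), he.parallel x hx, he.parallel x hx]
  simp only [zero_apply, inner_sub_left, inner_zero_right, inner_zero_left]
  ring

/-! ### Iterated brackets and curvature -/

section Bracket

variable [IsContMDiffRiemannianBundle 𝓘(ℝ, E) ∞ E (fun x : M ↦ TangentSpace 𝓘(ℝ, E) x)]

/-- Killing fields are closed under the Lie bracket. -/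
lemma isKillingOn_mlieBracket (he : IsParallelOrthonormalFrameOn nabla e U)
    (hLC : IsLeviCivita nablaG) (hU : IsOpen U) (hX : IsKillingOn X U) (hY : IsKillingOn Y U) :
    IsKillingOn (mlieBracket 𝓘(ℝ, E) X Y) U := by
  have hXY := contMDiffOn_mlieBracket hU hX.1 hY.1
  refine (he.isKillingOn_iff hLC hU hXY).2 fun x hx k l ↦ ?_
  -- Derivative along `V` of the Killing equation for `W`. The terms pairing a bracket with `V`
  -- and a bracket with `W` are symmetric in `V` and `W`, so they cancel after antisymmetrization.
  have key {V W : Π x : M, TangentSpace 𝓘(ℝ, E) x} (hV : IsKillingOn V U) (hW : IsKillingOn W U) :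
      (inner ℝ (mlieBracket 𝓘(ℝ, E) V (mlieBracket 𝓘(ℝ, E) W (e k)) x) (e l x) : ℝ)
        + inner ℝ (mlieBracket 𝓘(ℝ, E) W (e k) x) (mlieBracket 𝓘(ℝ, E) V (e l) x)
        + (inner ℝ (mlieBracket 𝓘(ℝ, E) V (mlieBracket 𝓘(ℝ, E) W (e l)) x) (e k x)
        + inner ℝ (mlieBracket 𝓘(ℝ, E) W (e l) x) (mlieBracket 𝓘(ℝ, E) V (e k) x)) = 0 := by
    have hWd (m) : MDiffAt (T% (mlieBracket 𝓘(ℝ, E) W (e m))) x :=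
      mdifferentiableAt_of_contMDiffOn hU (contMDiffOn_mlieBracket hU hW.1 (he.contMDiffOn m)) hx
    have hed := he.mdifferentiableAt hU hx
    rw [← hV.2 x hx _ _ (hWd k) (hed l), ← hV.2 x hx _ _ (hWd l) (hed k), ← add_apply,
      ← mvfderiv_fun_add (mdifferentiableAt_inner (hWd k) (hed l))
        (mdifferentiableAt_inner (hWd l) (hed k)),
      mvfderiv_congr (g := fun _ ↦ 0), mvfderiv_const, zero_apply]
    filter_upwards [hU.mem_nhds hx] with y hy
    exact (he.isKillingOn_iff hLC hU hW.1).1 hW y hy k l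
  rw [jacobi_mlieBracket hU hX.1 hY.1 (he.contMDiffOn k) hx,
    jacobi_mlieBracket hU hX.1 hY.1 (he.contMDiffOn l) hx, inner_sub_left, inner_sub_left]
  have h1 := key hX hY
  have h2 := key hY hX
  rw [real_inner_comm (mlieBracket 𝓘(ℝ, E) Y (e l) x),
    real_inner_comm (mlieBracket 𝓘(ℝ, E) Y (e k) x)] at h2
  linarith

/-- The iterated brackets of a parallel frame in terms of the torsion: by total antisymmetry, the
Jacobi identity determines the derivatives of the structure functions. -/
lemma three_smul_mlieBracket_mlieBracket (he : IsParallelOrthonormalFrameOn nabla e U)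
    (hLC : IsLeviCivita nablaG) (hmetric : IsMetric nabla) (hskew : HasSkewTorsion nabla)
    (hU : IsOpen U) (hx : x ∈ U) (i j k : Fin n) :
    (3 : ℝ) • mlieBracket 𝓘(ℝ, E) (mlieBracket 𝓘(ℝ, E) (e i) (e j)) (e k) x =
      -(2 : ℝ) • nabla.torsion x (mlieBracket 𝓘(ℝ, E) (e i) (e j) x) (e k x)
        + nabla.torsion x (mlieBracket 𝓘(ℝ, E) (e j) (e k) x) (e i x)
        - nabla.torsion x (mlieBracket 𝓘(ℝ, E) (e i) (e k) x) (e j x) := by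
  refine he.ext_inner hx fun l ↦ ?_
  -- `Q i j k l` is the derivative along `e k` of the structure function of `e i`, `e j`, `e l`.
  let Q (i j k l : Fin n) : ℝ :=
    d% (fun y ↦ (inner ℝ (mlieBracket 𝓘(ℝ, E) (e i) (e j) y) (e l y) : ℝ)) x (e k x)
  have hQ (i j k l) : Q i j k l = _ := he.mvfderiv_structureFunction hmetric hU hx i j k l
  have swap₁₂ (i j k l) : Q i j k l = -Q j i k l := by
    simp only [Q]
    rw [← neg_apply, ← mvfderiv_fun_neg]
    congr 2
    ext y
    rw [mlieBracket_swap_apply, inner_neg_left]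
  have swap₂₄ (i j k l) : Q i j k l = -Q i l k j := by
    simp only [Q]
    rw [← neg_apply, ← mvfderiv_fun_neg]
    refine congr($(mvfderiv_congr ?_) _)
    filter_upwards [hU.mem_nhds hx] with y hy
    rw [he.mlieBracket_eq_neg_torsion hU hy, he.mlieBracket_eq_neg_torsion hU hy, inner_neg_left,
      inner_neg_left, (hskew y (e i y) (e j y) (e l y)).2]
  -- `[e i, e j]` is a Killing field.
  have swap₃₄ (i j k l) : Q i j k l = -Q i j l k := by
    have hK := he.isKillingOn_mlieBracket hLC hU (he.isKillingOn_frame hLC hskew hU i)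
      (he.isKillingOn_frame hLC hskew hU j)
    have h := (he.isKillingOn_iff hLC hU hK.1).1 hK x hx k l
    have h' := (hskew x (mlieBracket 𝓘(ℝ, E) (e i) (e j) x) (e k x) (e l x)).2
    rw [hQ, hQ]
    linarith
  -- The transpositions found so far generate all permutations of the four indices.
  have swap₂₃ (i j k l) : Q i j k l = -Q i k j l := by
    linarith [swap₂₄ i j k l, swap₃₄ i l k j, swap₂₄ i l j k]
  have h1 : Q j k i l = Q i j k l := by linarith [swap₂₃ j k i l, swap₁₂ j i k l]
  have h2 : Q i k j l = -Q i j k l := swap₂₃ i k j l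
  have hJ := congr((inner ℝ $(jacobi_mlieBracket hU (he.contMDiffOn i) (he.contMDiffOn j)
    (he.contMDiffOn k) hx) (e l x) : ℝ))
  -- Nest all brackets on the left, as in `hQ`.
  rw [mlieBracket_swap_apply (V := e i), mlieBracket_swap_apply (V := e j) (W := mlieBracket _ _ _)]
    at hJ
  rw [hQ, hQ] at h1 h2
  simp only [inner_sub_left, inner_add_left, inner_smul_left, inner_neg_left, conj_trivial] at hJ ⊢
  linarith

theorem curvature_frame (he : IsParallelOrthonormalFrameOn nabla e U)
    (hLC : IsLeviCivita nablaG) (hmetric : IsMetric nabla) (hskew : HasSkewTorsion nabla)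
    (hU : IsOpen U) (hx : x ∈ U) (i j k : Fin n) :
    curvature nablaG (e i) (e j) (e k) x =
      -(1 / 4 : ℝ) • mlieBracket 𝓘(ℝ, E) (mlieBracket 𝓘(ℝ, E) (e i) (e j)) (e k) x := by
  have hb (a b) : MDiffAt (T% (mlieBracket 𝓘(ℝ, E) (e a) (e b))) x :=
    mdifferentiableAt_of_contMDiffOn hU
      (contMDiffOn_mlieBracket hU (he.contMDiffOn a) (he.contMDiffOn b)) hx
  -- `∇^g_{e a} ∇^g_{e b} (e k)` with `∇^g_{e b} (e k) = 1/2 [e b, e k]`, where the outer derivative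
  -- is exchanged with that of `e a`, the torsion being zero.
  have second (a b) : nablaG (fun y ↦ nablaG (e k) y (e b y)) x (e a x) =
      (1 / 2 : ℝ) • (mlieBracket 𝓘(ℝ, E) (e a) (mlieBracket 𝓘(ℝ, E) (e b) (e k)) x
        - (1 / 2 : ℝ) • nabla.torsion x (mlieBracket 𝓘(ℝ, E) (e b) (e k) x) (e a x)) := by
    have hev : (fun y ↦ nablaG (e k) y (e b y)) =ᶠ[𝓝 x]
        (1 / 2 : ℝ) • mlieBracket 𝓘(ℝ, E) (e b) (e k) := by
      filter_upwards [hU.mem_nhds hx] with y hy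
      rw [he.leviCivita_frame hLC hskew hU hy, Pi.smul_apply,
        he.mlieBracket_eq_neg_torsion hU hy, smul_neg, neg_smul]
    rw [cov_congr nablaG hev (mdifferentiableAt_const.smul_section (hb b k)),
      nablaG.isCovariantDerivativeOnUniv.smul_const _ (hb b k),
      hLC.mlieBracket_eq (he.mdifferentiableAt hU hx a) (hb b k),
      he.leviCivita_frame hLC hskew hU hx]
    simp only [smul_apply]
    module
  have h3 := he.three_smul_mlieBracket_mlieBracket hLC hmetric hskew hU hx i j k
  have hJ := jacobi_mlieBracket hU (he.contMDiffOn i) (he.contMDiffOn j) (he.contMDiffOn k) hx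
  rw [curvature, second, second, he.leviCivita_frame hLC hskew hU hx]
  linear_combination (norm := module) (-(1 / 2 : ℝ)) • hJ + (1 / 4 : ℝ) • h3

end Bracket

end IsParallelOrthonormalFrameOn

end Riemannian
end SkewTorsion

theorem mainTheorem7
    {E : Type*} [NormedAddCommGroup E] [NormedSpace ℝ E] [FiniteDimensional ℝ E]
    {M : Type*} [TopologicalSpace M] [T2Space M] [ChartedSpace E M] [IsManifold 𝓘(ℝ, E) ∞ M]
    [RiemannianBundle (fun x : M ↦ TangentSpace 𝓘(ℝ, E) x)]
    [IsContMDiffRiemannianBundle 𝓘(ℝ, E) ∞ E (fun x : M ↦ TangentSpace 𝓘(ℝ, E) x)]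
    (nabla nablaG : CovariantDerivative 𝓘(ℝ, E) E (fun x : M ↦ TangentSpace 𝓘(ℝ, E) x))
    [nabla.ContMDiffCovariantDerivative ∞]
    (hmetric : SkewTorsion.IsMetric nabla)
    (hflat : SkewTorsion.IsFlat nabla)
    (hskew : SkewTorsion.HasSkewTorsion nabla)
    (hLC : SkewTorsion.IsLeviCivita nablaG)
    (U : Set M) (hU : IsOpen U)
    {n : ℕ} (e : Fin n → Π x : M, TangentSpace 𝓘(ℝ, E) x)
    (he : SkewTorsion.IsParallelOrthonormalFrameOn nabla e U) :
    (∀ i, SkewTorsion.IsKillingOn (e i) U) ∧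
    (∀ i j k, ∀ x ∈ U, SkewTorsion.curvature nablaG (e i) (e j) (e k) x =
      -(1 / 4 : ℝ) • mlieBracket 𝓘(ℝ, E) (mlieBracket 𝓘(ℝ, E) (e i) (e j)) (e k) x) ∧
    (∀ i j k, SkewTorsion.IsKillingOn
      (SkewTorsion.curvature nablaG (e i) (e j) (e k)) U) := by
  have hK := he.isKillingOn_frame hLC hskew hU
  have hcurv (i j k : Fin n) (x : M) (hx : x ∈ U) :=
    he.curvature_frame hLC hmetric hskew hU hx i j k
  exact ⟨hK, hcurv, fun i j k ↦ SkewTorsion.IsKillingOn.congr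
    (SkewTorsion.IsKillingOn.const_smul (he.isKillingOn_mlieBracket hLC hU
      (he.isKillingOn_mlieBracket hLC hU (hK i) (hK j)) (hK k)) hU _) hU (hcurv i j k)⟩
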